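/- For $X\in M_n(\mathbb C)$ let $|X|'=(XX^*)^{1/2}$ be the positive semidefinite factor of the left polar decomposition $X=|X|'U$, $U$ unitary. For $A\in M_n(\mathbb C)$ let $|\lambda_1(A)|\ge\cdots\ge|\lambda_n(A)|$ be the moduli of the eigenvalues of $A$ counted with algebraic multiplicity, and put $D=\operatorname{diag}(|\lambda_1(A)|,\dots,|\lambda_n(A)|)$. The hyperbolic element $H$ of $A$ is the matrix that acts as multiplication by $|\mu|$ on the generalized eigenspace of $A$ for each eigenvalue $\mu$; equivalently, if $A=PJP^{-1}$ with $J$ a Jordan canonical form of $A$, then $H=P\operatorname{diag}(|J_{11}|,\dots,|J_{nn}|)P^{-1}$. In particular $H=MDM^{-1}$ for some $M\in \mathrm{GL}_n(\mathbb C)$. Corollary. Let $A\in M_n(\mathbb C)$ and $B\in\mathrm{GL}_n(\mathbb C)$. There is a matrix $X\in M_n(\mathbb C)$, depending only on $A$ and $B$, such that $$\lim_{m\to\infty}\bigl(|BA^mC|'\bigr)^{1/m}=X\qquad\text{for every } C\in\mathrm{GL}_n(\mathbb C),$$ and such that, for every $M\in\mathrm{GL}_n(\mathbb C)$ with $H=MDM^{-1}$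 and every factorization $BM=QR$ with $Q$ unitary and $R$ upper triangular, $$X=QDQ^*.$$ In particular the limit is independent of $C$ and of the choice of $M$. -/

import Mathlib

open scoped MatrixOrder ComplexOrder Matrix Topology

/-- The moduli `|λ₁(A)| ≥ ⋯ ≥ |λₙ(A)|` of the eigenvalues of `A`, counted with algebraic
multiplicity, as a non-increasing list. -/
noncomputable def eigenvalueModuliList {n : ℕ} (A : Matrix (Fin n) (Fin n) ℂ) : List ℝ :=
  (A.charpoly.roots.map (fun z : ℂ => ‖z‖)).sort (· ≥ ·)

theorem length_eigenvalueModuliList {n : ℕ} (A : Matrix (Fin n) (Fin n) ℂ) :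
    (eigenvalueModuliList A).length = n := by
  rw [eigenvalueModuliList, Multiset.length_sort, Multiset.card_map,
    ← (IsAlgClosed.splits A.charpoly).natDegree_eq_card_roots, Matrix.charpoly_natDegree_eq_dim,
    Fintype.card_fin]

/-- `|λ_i(A)|`: the `i`-th largest eigenvalue modulus of `A`, counted with multiplicity. -/
noncomputable def eigenvalueModulus {n : ℕ} (A : Matrix (Fin n) (Fin n) ℂ) (i : Fin n) : ℝ :=
  (eigenvalueModuliList A).get (i.cast (length_eigenvalueModuliList A).symm)

/-- `D = diag(|λ₁(A)|, …, |λₙ(A)|)`. -/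
noncomputable def moduliDiagonal {n : ℕ} (A : Matrix (Fin n) (Fin n) ℂ) :
    Matrix (Fin n) (Fin n) ℂ :=
  Matrix.diagonal fun i => (eigenvalueModulus A i : ℂ)

/-- The generalized eigenspace of `A` for `μ` (zero if `μ` is not an eigenvalue). -/
noncomputable def genEigenspace {n : ℕ} (A : Matrix (Fin n) (Fin n) ℂ) (μ : ℂ) :
    Submodule ℂ (Fin n → ℂ) :=
  Module.End.maxGenEigenspace (Matrix.toLin' A) μ

theorem isCompl_genEigenspace {n : ℕ} (A : Matrix (Fin n) (Fin n) ℂ) (μ : ℂ) :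
    IsCompl (genEigenspace A μ) (⨆ ν, ⨆ (_ : ν ≠ μ), genEigenspace A ν) := by
  refine ⟨Module.End.independent_maxGenEigenspace (Matrix.toLin' A) μ, ?_⟩
  rw [codisjoint_iff, eq_top_iff, ← Module.End.iSup_maxGenEigenspace_eq_top (Matrix.toLin' A)]
  refine iSup_le fun ν => ?_
  by_cases h : ν = μ
  · subst h
    exact le_sup_left
  · exact le_sup_of_le_right (le_iSup₂_of_le ν h le_rfl)

/-- The projection of `ℂⁿ` onto the generalized eigenspace of `A` for `μ` along the sum of all
other generalized eigenspaces. -/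
noncomputable def genEigenProjection {n : ℕ} (A : Matrix (Fin n) (Fin n) ℂ) (μ : ℂ) :
    (Fin n → ℂ) →ₗ[ℂ] (Fin n → ℂ) :=
  Submodule.projection _ _ (isCompl_genEigenspace A μ)

/-- The hyperbolic element of `A`: the matrix acting as multiplication by `|μ|` on the generalized
eigenspace of `A` for each eigenvalue `μ`. The theorem `hyperbolicElement_eq_of_jordan` below shows
that it is given by the usual formula in terms of a Jordan form of `A`. -/
noncomputable def hyperbolicElement {n : ℕ} (A : Matrix (Fin n) (Fin n) ℂ) :
    Matrix (Fin n) (Fin n) ℂ :=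
  LinearMap.toMatrix' (∑ μ ∈ A.charpoly.roots.toFinset, (‖μ‖ : ℂ) • genEigenProjection A μ)

theorem hyperbolicElement_mulVec {n : ℕ} (A : Matrix (Fin n) (Fin n) ℂ) (μ : ℂ) (v : Fin n → ℂ)
    (hv : v ∈ genEigenspace A μ) : hyperbolicElement A *ᵥ v = (‖μ‖ : ℂ) • v := by
  have hother : ∀ ν, ν ≠ μ → genEigenProjection A ν v = 0 := by
    intro ν hν
    refine (Submodule.projection_apply_eq_zero_iff (isCompl_genEigenspace A ν)).2 ?_
    exact (le_iSup₂_of_le (f := fun κ (_ : κ ≠ ν) => genEigenspace A κ) μ hν.symm le_rfl) hv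
  have hself : genEigenProjection A μ v = v :=
    Submodule.projection_apply_of_mem_left (isCompl_genEigenspace A μ) hv
  rw [hyperbolicElement, LinearMap.toMatrix'_mulVec, LinearMap.sum_apply]
  by_cases hμ : μ ∈ A.charpoly.roots.toFinset
  · rw [Finset.sum_eq_single_of_mem μ hμ]
    · rw [LinearMap.smul_apply, hself]
    · intro ν _ hν
      rw [LinearMap.smul_apply, hother ν hν, smul_zero]
  · have hv0 : v = 0 := by
      by_contra hne
      apply hμ
      have hbot : Module.End.maxGenEigenspace (Matrix.toLin' A) μ ≠ ⊥ := by
        intro hb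
        apply hne
        have : v ∈ Module.End.maxGenEigenspace (Matrix.toLin' A) μ := hv
        rwa [hb, Submodule.mem_bot] at this
      have hev : Module.End.HasEigenvalue (Matrix.toLin' A) μ := by
        rw [Module.End.HasEigenvalue, Module.End.HasUnifEigenvalue]
        intro h1
        apply hbot
        rw [Module.End.maxGenEigenspace, Module.End.genEigenspace_top]
        refine (iSup_eq_bot.2 fun k => ?_)
        by_contra hk
        exact (Module.End.hasEigenvalue_of_hasGenEigenvalue (k := k) hk) h1
      rw [Multiset.mem_toFinset, Polynomial.mem_roots A.charpoly_monic.ne_zero,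
        ← Matrix.charpoly_toLin']
      exact (Module.End.hasEigenvalue_iff_isRoot_charpoly _ _).1 hev
    subst hv0
    simp

/-- `J` is a Jordan matrix, that is, a direct sum of Jordan blocks: nonzero entries occur only on
the diagonal and the first superdiagonal, the superdiagonal entries are `0` or `1`, and an entry
`1` joins equal diagonal entries. -/
def IsJordanMatrix {n : ℕ} (J : Matrix (Fin n) (Fin n) ℂ) : Prop :=
  ∀ i j : Fin n, i ≠ j →
    J i j = 0 ∨ (J i j = 1 ∧ (j : ℕ) = i + 1 ∧ J i i = J j j)

/-- If `A = M J M⁻¹` with `J` a Jordan matrix, then the hyperbolic element of `A` is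
`M diag(|J₁₁|, …, |Jₙₙ|) M⁻¹`. -/
theorem hyperbolicElement_eq_of_jordan {n : ℕ} (A J : Matrix (Fin n) (Fin n) ℂ)
    (M : Matrix.GeneralLinearGroup (Fin n) ℂ) (hJ : IsJordanMatrix J)
    (hA : A = M.val * J * (M⁻¹).val) :
    hyperbolicElement A = M.val * Matrix.diagonal (fun i => (‖J i i‖ : ℂ)) * (M⁻¹).val := by
  have hAM : A * M.val = M.val * J := by
    rw [hA, mul_assoc, M.inv_mul, mul_one]
  have hsum : ∀ k, A *ᵥ (M.val *ᵥ Pi.single k 1) =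
      ∑ i, J i k • (M.val *ᵥ Pi.single i 1) := by
    intro k
    have h1 : J *ᵥ Pi.single k 1 = ∑ i, J i k • (Pi.single i 1 : Fin n → ℂ) := by
      rw [Matrix.mulVec_single_one]
      exact pi_eq_sum_univ' (J.col k)
    rw [Matrix.mulVec_mulVec, hAM, ← Matrix.mulVec_mulVec, h1, Matrix.mulVec_sum]
    exact Finset.sum_congr rfl fun i _ => Matrix.mulVec_smul _ _ _
  have hcol : ∀ (k : ℕ) (hk : k < n),
      M.val *ᵥ Pi.single ⟨k, hk⟩ 1 ∈ genEigenspace A (J ⟨k, hk⟩ ⟨k, hk⟩) := by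
    intro k
    induction k using Nat.strong_induction_on with
    | _ k ih =>
      intro hk
      have hmem : (Matrix.toLin' A - J ⟨k, hk⟩ ⟨k, hk⟩ • (1 : Module.End ℂ (Fin n → ℂ)))
          (M.val *ᵥ Pi.single ⟨k, hk⟩ 1) ∈ genEigenspace A (J ⟨k, hk⟩ ⟨k, hk⟩) := by
        rw [LinearMap.sub_apply, LinearMap.smul_apply, Module.End.one_apply, Matrix.toLin'_apply,
          hsum, ← Finset.sum_erase_add _ _ (Finset.mem_univ (⟨k, hk⟩ : Fin n)), add_sub_cancel_right]
        refine Submodule.sum_mem _ fun i hi => ?_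
        rcases hJ i ⟨k, hk⟩ (Finset.ne_of_mem_erase hi) with h0 | ⟨h1, h2, h3⟩
        · rw [h0, zero_smul]
          exact Submodule.zero_mem _
        · refine Submodule.smul_mem _ _ ?_
          rw [← h3]
          have h2' : k = (i : ℕ) + 1 := h2
          exact ih i (by omega) i.2
      rw [genEigenspace, Module.End.mem_maxGenEigenspace] at hmem ⊢
      obtain ⟨p, hp⟩ := hmem
      exact ⟨p + 1, by rw [pow_succ, Module.End.mul_apply]; exact hp⟩
  have hHM : hyperbolicElement A * M.val =
      M.val * Matrix.diagonal (fun i => (‖J i i‖ : ℂ)) := by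
    refine Matrix.ext_of_mulVec_single fun k => ?_
    rw [← Matrix.mulVec_mulVec, ← Matrix.mulVec_mulVec,
      hyperbolicElement_mulVec A _ _ (hcol k k.2), Matrix.diagonal_mulVec_single, mul_one,
      ← Matrix.mulVec_smul]
    congr 1
    rw [← Pi.single_smul, smul_eq_mul, mul_one]
  rw [← hHM, mul_assoc, M.mul_inv, mul_one]

/-- The positive semidefinite factor `|X|' = (X X^*)^{1/2}` of the left polar decomposition
`X = |X|' U`. -/
noncomputable def leftAbs {n : ℕ} (X : Matrix (Fin n) (Fin n) ℂ) : Matrix (Fin n) (Fin n) ℂ :=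
  CFC.sqrt (X * Xᴴ)

/-!
Let `H` be the hyperbolic element of `A` and let `N` act as `‖μ‖⁻¹ A` on the generalized eigenspace
of each eigenvalue `μ ≠ 0` and as the identity on that of `0`. Then `A ^ m = H ^ m N ^ m` for large
`m`, and the spectrum of `N` lies on the unit circle, so `N ^ m` and its inverse grow
subexponentially by Gelfand's formula. If `H = M D M⁻¹` and `B M = Q R`, then `R D ^ m = D ^ m S_m`,
where `S_m` and its inverse stay bounded because `D` is sorted. With `E = Q D Qᴴ` this gives
`B A ^ m C = E ^ m y_m`, where `y_m = Q S_m M⁻¹ N ^ m C` and its inverse grow subexponentially. For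
every `r > 1` and large `m` it follows that `r⁻ᵐ E ^ m ≤ |B A ^ m C|' ≤ rᵐ E ^ m`, and since taking
`m`-th roots is operator monotone, the roots are squeezed between `r⁻¹ E` and `r E`.
-/

open Filter ExpGrowth

section Growth

theorem expGrowthSup_mul_nonpos {u v : ℕ → ENNReal} (hu : expGrowthSup u ≤ 0)
    (hv : expGrowthSup v ≤ 0) : expGrowthSup (u * v) ≤ 0 :=
  (expGrowthSup_mul_le (.inr (hv.trans_lt EReal.zero_lt_top).ne)
    (.inl (hu.trans_lt EReal.zero_lt_top).ne)).trans (add_nonpos hu hv)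

theorem expGrowthSup_nonpos_of_forall_le {u : ℕ → ENNReal} {c : ENNReal} (hc : c ≠ ⊤)
    (hu : ∀ m, u m ≤ c) : expGrowthSup u ≤ 0 := by
  have hle : expGrowthSup u ≤ expGrowthSup (fun _ => (1 : ENNReal)) :=
    expGrowthSup_le_of_eventually_le hc (Eventually.of_forall fun m => by simpa using hu m)
  rwa [expGrowthSup_const one_ne_zero ENNReal.one_ne_top] at hle

theorem eventually_norm_le_pow_of_expGrowthSup_nonpos {E : Type*} [SeminormedAddGroup E]
    {f : ℕ → E} (hf : expGrowthSup (fun m => ‖f m‖ₑ) ≤ 0) {r : ℝ} (hr : 1 < r) :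
    ∀ᶠ m in atTop, ‖f m‖ ≤ r ^ m := by
  have hr0 : 0 ≤ r := zero_le_one.trans hr.le
  have hlog : expGrowthSup (fun m => ‖f m‖ₑ) < ENNReal.log (ENNReal.ofReal r) :=
    hf.trans_lt (ENNReal.zero_lt_log_iff.2 (by simpa using hr))
  filter_upwards [eventually_le_exp hlog] with m hm
  rw [mul_comm, EReal.exp_nmul, ENNReal.exp_log, ← ENNReal.ofReal_pow hr0, ← ofReal_norm] at hm
  exact (ENNReal.ofReal_le_ofReal_iff (pow_nonneg hr0 m)).1 hm

theorem expGrowthSup_enorm_pow {𝒜 : Type*} [NormedRing 𝒜] [NormedAlgebra ℂ 𝒜] [CompleteSpace 𝒜]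
    (a : 𝒜) : expGrowthSup (fun m => ‖a ^ m‖ₑ) = ENNReal.log (spectralRadius ℂ a) := by
  have hlim := (ENNReal.continuous_log.tendsto _).comp
    (spectrum.pow_nnnorm_pow_one_div_tendsto_nhds_spectralRadius a)
  refine (Tendsto.congr (fun m => ?_) hlim).limsup_eq
  simp [ENNReal.log_rpow, EReal.div_eq_inv_mul, enorm_eq_nnnorm, EReal.coe_inv]

variable (𝒜 : Type*) [NormedRing 𝒜]

/-- The group of sequences of units `u` of a normed ring for which both `‖u m‖` and `‖(u m)⁻¹‖`
grow subexponentially in `m`, in the sense that their exponential growth rate is at most `0`. -/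
def subexponentialUnits : Subgroup (ℕ → 𝒜ˣ) where
  carrier := {u | expGrowthSup (fun m => ‖(u m : 𝒜)‖ₑ) ≤ 0 ∧
    expGrowthSup (fun m => ‖(↑(u m)⁻¹ : 𝒜)‖ₑ) ≤ 0}
  one_mem' := by
    constructor <;> exact expGrowthSup_nonpos_of_forall_le enorm_ne_top fun _ => le_rfl
  mul_mem' {u v} hu hv := by
    refine ⟨(expGrowthSup_monotone fun m => ?_).trans (expGrowthSup_mul_nonpos hu.1 hv.1),
      (expGrowthSup_monotone fun m => ?_).trans (expGrowthSup_mul_nonpos hv.2 hu.2)⟩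
    · simpa [enorm_eq_nnnorm, ← ENNReal.coe_mul] using nnnorm_mul_le (u m : 𝒜) (v m : 𝒜)
    · simpa [enorm_eq_nnnorm, ← ENNReal.coe_mul] using nnnorm_mul_le (↑(v m)⁻¹ : 𝒜) (↑(u m)⁻¹ : 𝒜)
  inv_mem' {u} hu := ⟨hu.2, by simpa using hu.1⟩

variable {𝒜}

theorem const_mem_subexponentialUnits (a : 𝒜ˣ) : (fun _ => a) ∈ subexponentialUnits 𝒜 :=
  ⟨expGrowthSup_nonpos_of_forall_le enorm_ne_top fun _ => le_rfl,
    expGrowthSup_nonpos_of_forall_le enorm_ne_top fun _ => le_rfl⟩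

theorem star_mem_subexponentialUnits [StarRing 𝒜] [NormedStarGroup 𝒜] {u : ℕ → 𝒜ˣ}
    (hu : u ∈ subexponentialUnits 𝒜) : star u ∈ subexponentialUnits 𝒜 := by
  constructor
  · simpa [enorm_eq_nnnorm, nnnorm_star] using hu.1
  · simpa [enorm_eq_nnnorm, nnnorm_star] using hu.2

theorem pow_mem_subexponentialUnits [NormedAlgebra ℂ 𝒜] [CompleteSpace 𝒜] {a : 𝒜ˣ}
    (ha : ∀ z ∈ spectrum ℂ (a : 𝒜), ‖z‖ = 1) : (fun m => a ^ m) ∈ subexponentialUnits 𝒜 := by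
  have hgrowth {b : 𝒜ˣ} (hb : ∀ z ∈ spectrum ℂ (b : 𝒜), ‖z‖ = 1) :
      expGrowthSup (fun m => ‖((b ^ m : 𝒜ˣ) : 𝒜)‖ₑ) ≤ 0 := by
    simp only [Units.val_pow_eq_pow_val]
    rw [expGrowthSup_enorm_pow, ENNReal.log_le_zero_iff]
    exact iSup₂_le fun z hz => by exact_mod_cast (hb z hz).le
  have hinv : ∀ z ∈ spectrum ℂ (↑a⁻¹ : 𝒜), ‖z‖ = 1 := fun z hz => by
    rw [← spectrum.map_inv, Set.mem_inv] at hz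
    simpa using ha _ hz
  exact ⟨hgrowth ha, by simpa only [inv_pow] using hgrowth hinv⟩

end Growth

section CStar

theorem tendsto_of_eventually_mem_Icc {𝒜 : Type*} [NonUnitalCStarAlgebra 𝒜] [PartialOrder 𝒜]
    [StarOrderedRing 𝒜] {ι κ : Type*} {l : Filter ι} {p : Filter κ} [p.NeBot] {x : ι → 𝒜}
    {a b : κ → 𝒜} {e : 𝒜} (ha : Tendsto a p (𝓝 e)) (hb : Tendsto b p (𝓝 e))
    (hx : ∀ᶠ k in p, ∀ᶠ i in l, x i ∈ Set.Icc (a k) (b k)) : Tendsto x l (𝓝 e) := by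
  have hgap : Tendsto (fun k => ‖b k - a k‖ + ‖a k - e‖) p (𝓝 0) := by
    simpa using (hb.sub ha).norm.add (ha.sub_const e).norm
  rw [tendsto_iff_norm_sub_tendsto_zero, Metric.tendsto_nhds]
  intro ε hε
  obtain ⟨k, hk, hxk⟩ := ((hgap.eventually_lt_const hε).and hx).exists
  filter_upwards [hxk] with i hi
  rw [dist_zero_right, norm_norm]
  calc ‖x i - e‖ ≤ ‖x i - a k‖ + ‖a k - e‖ := norm_sub_le_norm_sub_add_norm_sub ..
    _ ≤ ‖b k - a k‖ + ‖a k - e‖ := by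
      gcongr
      exact CStarAlgebra.norm_le_norm_of_nonneg_of_le (sub_nonneg.2 hi.1) (sub_le_sub_right hi.2 _)
    _ < ε := hk

variable {𝒜 : Type*} [CStarAlgebra 𝒜] [PartialOrder 𝒜] [StarOrderedRing 𝒜]

theorem abs_mul_le_norm_smul_abs (a b : 𝒜) : CFC.abs (a * b) ≤ ‖a‖ • CFC.abs b := by
  have hsq : star (a * b) * (a * b) ≤ star (‖a‖ • b) * (‖a‖ • b) := by
    have h := star_left_conjugate_le_conjugate
      (CStarAlgebra.star_mul_le_algebraMap_norm_sq (a := a)) b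
    simpa [mul_assoc, Algebra.algebraMap_eq_smul_one, smul_smul, sq] using h
  calc CFC.abs (a * b) ≤ CFC.abs (‖a‖ • b) := CFC.sqrt_le_sqrt _ _ hsq
    _ = ‖a‖ • CFC.abs b := by rw [CFC.abs_smul, norm_norm]

theorem pow_rpow_one_div {a : 𝒜} (ha : 0 ≤ a) {k : ℕ} (hk : k ≠ 0) :
    (a ^ k) ^ (1 / (k : ℝ)) = a := by
  rw [← CFC.rpow_natCast a k, CFC.rpow_rpow_of_exponent_nonneg _ _ _ (by positivity)
    (by positivity), mul_one_div_cancel (by positivity), CFC.rpow_one a]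

theorem abs_units_mul_pow_mem_Icc {e : 𝒜} (he : 0 ≤ e) {u : 𝒜ˣ} {r : ℝ} (hr : 0 < r) {m : ℕ}
    (hu : ‖(u : 𝒜)‖ ≤ r ^ m) (hu' : ‖(↑u⁻¹ : 𝒜)‖ ≤ r ^ m) :
    CFC.abs (u * e ^ m) ∈ Set.Icc ((r⁻¹ • e) ^ m) ((r • e) ^ m) := by
  have hem0 : 0 ≤ e ^ m := CStarAlgebra.pow_nonneg he m
  have hem : CFC.abs (e ^ m) = e ^ m := CFC.abs_of_nonneg _ hem0
  have hupper : CFC.abs (u * e ^ m) ≤ r ^ m • e ^ m :=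
    (abs_mul_le_norm_smul_abs _ _).trans (hem.symm ▸ smul_le_smul_of_nonneg_right hu hem0)
  have hlower : e ^ m ≤ r ^ m • CFC.abs (u * e ^ m) := by
    calc e ^ m = CFC.abs (↑u⁻¹ * (u * e ^ m)) := by rw [Units.inv_mul_cancel_left, hem]
      _ ≤ ‖(↑u⁻¹ : 𝒜)‖ • CFC.abs (u * e ^ m) := abs_mul_le_norm_smul_abs _ _
      _ ≤ r ^ m • CFC.abs (u * e ^ m) := smul_le_smul_of_nonneg_right hu' (CFC.abs_nonneg _)
  rw [smul_pow, smul_pow, inv_pow]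
  exact ⟨(inv_smul_le_iff_of_pos (pow_pos hr m)).2 hlower, hupper⟩

theorem rpow_one_div_mem_Icc {a b x : 𝒜} (ha : 0 ≤ a) (hb : 0 ≤ b) {m : ℕ} (hm : m ≠ 0)
    (hx : x ∈ Set.Icc (a ^ m) (b ^ m)) : x ^ (1 / (m : ℝ)) ∈ Set.Icc a b := by
  have hexp : 1 / (m : ℝ) ∈ Set.Icc (0 : ℝ) 1 :=
    ⟨by positivity, (div_le_one (by positivity)).2 (by exact_mod_cast Nat.one_le_iff_ne_zero.2 hm)⟩
  have h1 := CFC.rpow_le_rpow hexp hx.1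
  have h2 := CFC.rpow_le_rpow hexp hx.2
  rw [pow_rpow_one_div ‹_› hm] at h1 h2
  exact ⟨h1, h2⟩

theorem tendsto_abs_units_mul_pow_rpow_one_div {e : 𝒜} (he : 0 ≤ e) {u : ℕ → 𝒜ˣ}
    (hu : u ∈ subexponentialUnits 𝒜) :
    Tendsto (fun m : ℕ => CFC.abs (u m * e ^ m) ^ (1 / (m : ℝ))) atTop (𝓝 e) := by
  have hlower : Tendsto (fun r : ℝ => r⁻¹ • e) (𝓝[>] 1) (𝓝 e) := by
    have hinv : Tendsto (fun r : ℝ => r⁻¹) (𝓝[>] 1) (𝓝 1) := by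
      simpa using (tendsto_inv₀ (one_ne_zero (α := ℝ))).mono_left nhdsWithin_le_nhds
    simpa using hinv.smul_const e
  have hupper : Tendsto (fun r : ℝ => r • e) (𝓝[>] 1) (𝓝 e) := by
    have hid : Tendsto (fun r : ℝ => r) (𝓝[>] 1) (𝓝 1) := nhdsWithin_le_nhds
    simpa using hid.smul_const e
  refine tendsto_of_eventually_mem_Icc hlower hupper ?_
  filter_upwards [self_mem_nhdsWithin] with r hr
  have hr0 : 0 < r := zero_lt_one.trans hr
  filter_upwards [eventually_norm_le_pow_of_expGrowthSup_nonpos hu.1 hr,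
    eventually_norm_le_pow_of_expGrowthSup_nonpos hu.2 hr, eventually_ne_atTop 0] with m hum hum' hm
  exact rpow_one_div_mem_Icc (smul_nonneg (inv_nonneg.2 hr0.le) he) (smul_nonneg hr0.le he) hm
    (abs_units_mul_pow_mem_Icc he hr0 hum hum')

end CStar

section Triangular

theorem exists_unitary_mul_isUpperTriangular {𝕜 ι : Type*} [RCLike 𝕜] [Fintype ι] [LinearOrder ι]
    [LocallyFiniteOrderBot ι] (G : Matrix ι ι 𝕜) :
    ∃ Q R : Matrix ι ι 𝕜, Q ∈ Matrix.unitaryGroup ι 𝕜 ∧ R.IsUpperTriangular ∧ G = Q * R := by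
  let e := EuclideanSpace.basisFun ι 𝕜
  let f : ι → EuclideanSpace 𝕜 ι := fun j => WithLp.toLp 2 (G.col j)
  have hcard : Module.finrank 𝕜 (EuclideanSpace 𝕜 ι) = Fintype.card ι := finrank_euclideanSpace
  let b := InnerProductSpace.gramSchmidtOrthonormalBasis hcard f
  refine ⟨e.toBasis.toMatrix b.toBasis, b.toBasis.toMatrix f, ?_,
    InnerProductSpace.gramSchmidtOrthonormalBasis_inv_isUpperTriangular hcard f, ?_⟩
  · rw [OrthonormalBasis.coe_toBasis]
    exact e.toMatrix_orthonormalBasis_mem_unitary b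
  · rw [Module.Basis.toMatrix_mul_toMatrix]
    ext i j
    simp [Module.Basis.toMatrix_apply, e, f]

section Field

variable {ι K : Type*} [Field K]

open Classical in
/-- The ratio `d j / d i` by which conjugation with `diagonal d` scales the `(i, j)` entry of a
matrix. For `d i = 0` it is `1` rather than the default value `0` of the division, which keeps
diagonal entries fixed. -/
noncomputable def diagonalRatio (d : ι → K) (i j : ι) : K :=
  if d i = 0 then 1 else d j / d i

/-- A substitute for `(diagonal d)⁻ᵐ * R * (diagonal d)ᵐ` that makes sense also when some `d i`
vanish. It is meaningful for upper triangular `R` and `d` whose zeros come last. -/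
noncomputable def diagonalPowConj (d : ι → K) (m : ℕ) (R : Matrix ι ι K) : Matrix ι ι K :=
  Matrix.of fun i j => R i j * diagonalRatio d i j ^ m

theorem diagonalRatio_self (d : ι → K) (i : ι) : diagonalRatio d i i = 1 := by
  by_cases hi : d i = 0 <;> simp [diagonalRatio, hi]

theorem diagonalPowConj_one [DecidableEq ι] (d : ι → K) (m : ℕ) :
    diagonalPowConj d m 1 = 1 := by
  ext i j
  rcases eq_or_ne i j with rfl | hij
  · simp [diagonalPowConj, diagonalRatio_self]
  · simp [diagonalPowConj, Matrix.one_apply_ne hij]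

variable [LinearOrder ι] {d : ι → K} (hd : Monotone fun i => d i = 0)
include hd

theorem mul_diagonalRatio {i j : ι} (hij : i ≤ j) : d i * diagonalRatio d i j = d j := by
  by_cases hi : d i = 0
  · rw [hi, zero_mul, hd hij hi]
  · rw [diagonalRatio, if_neg hi, mul_div_cancel₀ _ hi]

theorem diagonalRatio_mul_diagonalRatio {i j k : ι} (hij : i ≤ j) (hjk : j ≤ k) :
    diagonalRatio d i j * diagonalRatio d j k = diagonalRatio d i k := by
  by_cases hi : d i = 0
  · simp [diagonalRatio, hi, show d j = 0 from hd hij hi]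
  · refine mul_left_cancel₀ hi ?_
    rw [← mul_assoc, mul_diagonalRatio hd hij, mul_diagonalRatio hd hjk,
      mul_diagonalRatio hd (hij.trans hjk)]

variable [Fintype ι] {R S : Matrix ι ι K} (hR : R.IsUpperTriangular)
include hR

theorem mul_diagonal_pow_eq_diagonal_pow_mul_diagonalPowConj (m : ℕ) :
    R * Matrix.diagonal d ^ m = Matrix.diagonal d ^ m * diagonalPowConj d m R := by
  ext i j
  rw [Matrix.diagonal_pow, Matrix.mul_diagonal, Matrix.diagonal_mul, diagonalPowConj,
    Matrix.of_apply, Pi.pow_apply, Pi.pow_apply]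
  rcases lt_or_ge j i with hji | hij
  · rw [hR hji, zero_mul, zero_mul, mul_zero]
  · rw [← mul_diagonalRatio hd hij, mul_pow, mul_left_comm]

theorem diagonalPowConj_mul (hS : S.IsUpperTriangular) (m : ℕ) :
    diagonalPowConj d m (R * S) = diagonalPowConj d m R * diagonalPowConj d m S := by
  ext i k
  simp only [diagonalPowConj, Matrix.of_apply, Matrix.mul_apply, Finset.sum_mul]
  refine Finset.sum_congr rfl fun j _ => ?_
  rcases lt_or_ge j i with hji | hij
  · simp [hR hji]
  rcases lt_or_ge k j with hkj | hjk
  · simp [hS hkj]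
  · rw [← diagonalRatio_mul_diagonalRatio hd hij hjk, mul_pow, mul_mul_mul_comm]

end Field

section Normed

variable {ι 𝕜 : Type*} [LinearOrder ι]

theorem norm_diagonalRatio_le_one [NormedField 𝕜] {d : ι → 𝕜} (hd : Antitone fun i => ‖d i‖)
    {i j : ι} (hij : i ≤ j) : ‖diagonalRatio d i j‖ ≤ 1 := by
  rw [diagonalRatio]
  split_ifs
  · exact norm_one.le
  · rw [norm_div]
    exact div_le_one_of_le₀ (hd hij) (norm_nonneg _)

theorem norm_diagonalPowConj_apply_le [NormedField 𝕜] {d : ι → 𝕜} (hd : Antitone fun i => ‖d i‖)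
    {R : Matrix ι ι 𝕜} (hR : R.IsUpperTriangular) (m : ℕ) (i j : ι) :
    ‖diagonalPowConj d m R i j‖ ≤ ‖R i j‖ := by
  rw [diagonalPowConj, Matrix.of_apply, norm_mul, norm_pow]
  rcases lt_or_ge j i with hji | hij
  · simp [hR hji]
  · exact mul_le_of_le_one_right (norm_nonneg _)
      (pow_le_one₀ (norm_nonneg _) (norm_diagonalRatio_le_one hd hij))

open scoped Matrix.Norms.L2Operator

theorem l2_opNorm_le_sum_norm_mul_norm_single {κ : Type*} [Fintype κ] [DecidableEq κ] [RCLike 𝕜]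
    (M : Matrix κ κ 𝕜) :
    ‖M‖ ≤ ∑ i, ∑ j, ‖M i j‖ * ‖Matrix.single i j (1 : 𝕜)‖ := by
  conv_lhs => rw [Matrix.matrix_eq_sum_single M]
  refine norm_sum_le_of_le _ fun i _ => norm_sum_le_of_le _ fun j _ => ?_
  rw [← norm_smul, Matrix.smul_single, smul_eq_mul, mul_one]

theorem exists_mem_subexponentialUnits_mul_diagonal_pow_eq [Fintype ι] [RCLike 𝕜]
    {d : ι → 𝕜} (hd : Antitone fun i => ‖d i‖) (R : (Matrix ι ι 𝕜)ˣ)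
    (hR : R.val.IsUpperTriangular) :
    ∃ S ∈ subexponentialUnits (Matrix ι ι 𝕜),
      ∀ m, R.val * Matrix.diagonal d ^ m = Matrix.diagonal d ^ m * (S m).val := by
  have hd0 : Monotone fun i => d i = 0 := fun i j hij hi =>
    norm_le_zero_iff.1 ((hd hij).trans (norm_eq_zero.2 hi).le)
  have hR' : (R⁻¹).val.IsUpperTriangular := by
    have := R.invertible
    rw [Matrix.coe_units_inv]
    exact Matrix.blockTriangular_inv_of_blockTriangular hR
  have hbound {T : Matrix ι ι 𝕜} (hT : T.IsUpperTriangular) :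
      expGrowthSup (fun m => ‖diagonalPowConj d m T‖ₑ) ≤ 0 :=
    expGrowthSup_nonpos_of_forall_le ENNReal.ofReal_ne_top fun m => by
      rw [← ofReal_norm]
      refine ENNReal.ofReal_le_ofReal ((l2_opNorm_le_sum_norm_mul_norm_single _).trans ?_)
      exact Finset.sum_le_sum fun i _ => Finset.sum_le_sum fun j _ =>
        mul_le_mul_of_nonneg_right (norm_diagonalPowConj_apply_le hd hT m i j) (norm_nonneg _)
  refine ⟨fun m => ⟨diagonalPowConj d m R, diagonalPowConj d m (R⁻¹).val, ?_, ?_⟩,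
    ⟨hbound hR, hbound hR'⟩, mul_diagonal_pow_eq_diagonal_pow_mul_diagonalPowConj hd0 hR⟩
  · rw [← diagonalPowConj_mul hd0 hR hR', R.mul_inv, diagonalPowConj_one]
  · rw [← diagonalPowConj_mul hd0 hR' hR, R.inv_mul, diagonalPowConj_one]

end Normed

end Triangular

theorem exists_list_map_eq {α β : Type*} {f : α → β} {s : Multiset α} {l : List β}
    (h : s.map f = l) : ∃ k : List α, (k : Multiset α) = s ∧ k.map f = l := by
  induction l generalizing s with
  | nil => exact ⟨[], (Multiset.map_eq_zero.1 h).symm, rfl⟩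
  | cons b l ih =>
    classical
    obtain ⟨a, ha, rfl, hs⟩ := (Multiset.map_eq_cons f s l b).2 h
    obtain ⟨k, hk, rfl⟩ := ih hs
    exact ⟨a :: k, by rw [← Multiset.cons_coe, hk, Multiset.cons_erase ha], rfl⟩

section Spectral

theorem exists_hasEigenvector_of_commute {K V : Type*} [Field K] [IsAlgClosed K] [AddCommGroup V]
    [Module K V] [FiniteDimensional K V] {f g : Module.End K V} (h : Commute f g) {z : K}
    (hz : g.HasEigenvalue z) : ∃ μ v, f.HasEigenvector μ v ∧ g.HasEigenvector z v := by
  have hmaps : ∀ v ∈ g.eigenspace z, f v ∈ g.eigenspace z :=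
    Module.End.mapsTo_genEigenspace_of_comm h.symm z 1
  have : Nontrivial (g.eigenspace z) := Submodule.nontrivial_iff_ne_bot.2 hz
  obtain ⟨μ, hμ⟩ := Module.End.exists_eigenvalue (f.restrict hmaps)
  obtain ⟨v, hv⟩ := hμ.exists_hasEigenvector
  have hv0 : (v : V) ≠ 0 := Submodule.coe_eq_zero.not.2 hv.2
  have hfv : f v = μ • (v : V) := congrArg Subtype.val hv.apply_eq_smul
  exact ⟨μ, v, ⟨Module.End.mem_eigenspace_iff.2 hfv, hv0⟩, v.2, hv0⟩

variable {n : ℕ} {A : Matrix (Fin n) (Fin n) ℂ}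

theorem ext_genEigenspace {S T : Matrix (Fin n) (Fin n) ℂ}
    (h : ∀ μ, ∀ v ∈ genEigenspace A μ, S *ᵥ v = T *ᵥ v) : S = T := by
  have hle : ⨆ μ, genEigenspace A μ ≤ LinearMap.eqLocus (Matrix.toLin' S) (Matrix.toLin' T) :=
    iSup_le fun μ v hv => h μ v hv
  refine Matrix.toLin'.injective (LinearMap.ext fun v => hle ?_)
  exact (Module.End.iSup_maxGenEigenspace_eq_top (Matrix.toLin' A)).ge Submodule.mem_top

theorem mulVec_mem_genEigenspace {S : Matrix (Fin n) (Fin n) ℂ} (hS : Commute A S) {μ : ℂ}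
    {v : Fin n → ℂ} (hv : v ∈ genEigenspace A μ) : S *ᵥ v ∈ genEigenspace A μ :=
  Module.End.mapsTo_maxGenEigenspace_of_comm (hS.map Matrix.toLinAlgEquiv') μ hv

variable (A) in
theorem finrank_genEigenspace (μ : ℂ) :
    Module.finrank ℂ (genEigenspace A μ) = A.charpoly.roots.count μ := by
  rw [genEigenspace, LinearMap.finrank_maxGenEigenspace_eq, Matrix.charpoly_toLin',
    Polynomial.count_roots]

theorem pow_mulVec_eq_zero {v : Fin n → ℂ} (hv : v ∈ genEigenspace A 0) {m : ℕ} (hm : n ≤ m) :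
    A ^ m *ᵥ v = 0 := by
  rw [genEigenspace, Module.End.maxGenEigenspace_eq_genEigenspace_finrank,
    Module.End.mem_genEigenspace_nat, zero_smul, sub_zero, LinearMap.mem_ker, ← Matrix.toLin'_pow,
    Matrix.toLin'_apply, Module.finrank_fin_fun] at hv
  rw [← Nat.sub_add_cancel hm, pow_add, ← Matrix.mulVec_mulVec, hv, Matrix.mulVec_zero]

theorem genEigenProjection_apply_self {μ : ℂ} {v : Fin n → ℂ} (hv : v ∈ genEigenspace A μ) :
    genEigenProjection A μ v = v :=
  Submodule.projection_apply_of_mem_left (isCompl_genEigenspace A μ) hv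

theorem genEigenProjection_apply_of_ne {μ ν : ℂ} (hμν : μ ≠ ν) {v : Fin n → ℂ}
    (hv : v ∈ genEigenspace A μ) : genEigenProjection A ν v = 0 :=
  (Submodule.projection_apply_eq_zero_iff (isCompl_genEigenspace A ν)).2
    (le_iSup₂_of_le (f := fun κ (_ : κ ≠ ν) => genEigenspace A κ) μ hμν le_rfl hv)

variable (A) in
/-- The matrix acting as multiplication by `f μ` on the generalized eigenspace of `A` for each
eigenvalue `μ`: the value at `f` of the functional calculus of the semisimple part of `A`. -/
noncomputable def genEigenScaling (f : ℂ → ℂ) : Matrix (Fin n) (Fin n) ℂ :=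
  LinearMap.toMatrix' (∑ μ ∈ A.charpoly.roots.toFinset, f μ • genEigenProjection A μ)

variable (A) in
theorem hyperbolicElement_eq_genEigenScaling :
    hyperbolicElement A = genEigenScaling A fun μ => (‖μ‖ : ℂ) := rfl

theorem genEigenScaling_mulVec (f : ℂ → ℂ) {μ : ℂ} {v : Fin n → ℂ} (hv : v ∈ genEigenspace A μ) :
    genEigenScaling A f *ᵥ v = f μ • v := by
  rw [genEigenScaling, LinearMap.toMatrix'_mulVec, LinearMap.sum_apply]
  simp only [LinearMap.smul_apply]
  rw [Finset.sum_eq_single μ, genEigenProjection_apply_self hv]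
  · intro ν _ hν
    rw [genEigenProjection_apply_of_ne hν.symm hv, smul_zero]
  · intro hμ
    have hbot : genEigenspace A μ = ⊥ := by
      rw [← Submodule.finrank_eq_zero (R := ℂ), finrank_genEigenspace]
      exact Multiset.count_eq_zero.2 fun h => hμ (Multiset.mem_toFinset.2 h)
    rw [hbot, Submodule.mem_bot] at hv
    rw [hv, map_zero, smul_zero]

theorem commute_genEigenScaling {S : Matrix (Fin n) (Fin n) ℂ} (hS : Commute A S) (f : ℂ → ℂ) :
    Commute S (genEigenScaling A f) :=
  ext_genEigenspace (A := A) fun μ v hv => by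
    rw [← Matrix.mulVec_mulVec, ← Matrix.mulVec_mulVec, genEigenScaling_mulVec f hv,
      genEigenScaling_mulVec f (mulVec_mem_genEigenspace hS hv), Matrix.mulVec_smul]

variable (A)

theorem genEigenScaling_mul (f g : ℂ → ℂ) :
    genEigenScaling A f * genEigenScaling A g = genEigenScaling A (f * g) :=
  ext_genEigenspace (A := A) fun μ v hv => by
    rw [← Matrix.mulVec_mulVec, genEigenScaling_mulVec g hv, Matrix.mulVec_smul,
      genEigenScaling_mulVec f hv, genEigenScaling_mulVec (f * g) hv, smul_smul, mul_comm,
      Pi.mul_apply]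

/-- The matrix acting as `‖μ‖⁻¹ • A` on the generalized eigenspace of `A` for each `μ ≠ 0`, that is,
as the product of the elliptic and unipotent parts of `A`. It is the identity on the generalized
eigenspace for `0`, which makes it invertible. -/
noncomputable def unimodularPart : Matrix (Fin n) (Fin n) ℂ :=
  A * genEigenScaling A (fun μ => (‖μ‖ : ℂ)⁻¹) + genEigenScaling A fun μ => if μ = 0 then 1 else 0

theorem commute_unimodularPart : Commute A (unimodularPart A) :=
  ((Commute.refl A).mul_right (commute_genEigenScaling (Commute.refl A) _)).add_right
    (commute_genEigenScaling (Commute.refl A) _)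

variable {A} in
theorem unimodularPart_mulVec {μ : ℂ} {v : Fin n → ℂ} (hv : v ∈ genEigenspace A μ) :
    unimodularPart A *ᵥ v = (‖μ‖ : ℂ)⁻¹ • A *ᵥ v + (if μ = 0 then (1 : ℂ) else 0) • v := by
  rw [unimodularPart, Matrix.add_mulVec, ← Matrix.mulVec_mulVec, genEigenScaling_mulVec _ hv,
    genEigenScaling_mulVec _ hv, Matrix.mulVec_smul]

theorem hyperbolicElement_mul_unimodularPart : hyperbolicElement A * unimodularPart A =
    A * genEigenScaling A fun μ => if μ = 0 then 0 else 1 :=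
  ext_genEigenspace (A := A) fun μ v hv => by
    rw [← Matrix.mulVec_mulVec, ← Matrix.mulVec_mulVec, genEigenScaling_mulVec _ hv,
      hyperbolicElement_mulVec A μ _ (mulVec_mem_genEigenspace (commute_unimodularPart A) hv),
      unimodularPart_mulVec hv, Matrix.mulVec_smul]
    by_cases hμ : μ = 0
    · simp [hμ]
    · simp [hμ, smul_smul]

theorem pow_mul_genEigenScaling_ite {m : ℕ} (hm : n ≤ m) :
    A ^ m * (genEigenScaling A fun μ => if μ = 0 then 0 else 1) = A ^ m :=
  ext_genEigenspace (A := A) fun μ v hv => by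
    rw [← Matrix.mulVec_mulVec, genEigenScaling_mulVec _ hv, Matrix.mulVec_smul]
    split_ifs with hμ
    · rw [pow_mulVec_eq_zero (hμ ▸ hv) hm, smul_zero]
    · rw [one_smul]

theorem pow_eq_hyperbolicElement_pow_mul_unimodularPart_pow {m : ℕ} (hm : n ≤ m) (hm0 : m ≠ 0) :
    A ^ m = hyperbolicElement A ^ m * unimodularPart A ^ m := by
  have hcomm : Commute (hyperbolicElement A) (unimodularPart A) := by
    rw [hyperbolicElement_eq_genEigenScaling]
    exact (commute_genEigenScaling (commute_unimodularPart A) _).symm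
  have hidem : IsIdempotentElem (genEigenScaling A fun μ => if μ = 0 then 0 else 1) := by
    rw [IsIdempotentElem, genEigenScaling_mul]
    congr 1
    ext μ
    simp
  rw [← hcomm.mul_pow, hyperbolicElement_mul_unimodularPart,
    (commute_genEigenScaling (Commute.refl A) _).mul_pow, hidem.pow_eq hm0,
    pow_mul_genEigenScaling_ite A hm]

variable {A}

theorem norm_eq_one_of_mem_spectrum_unimodularPart {z : ℂ}
    (hz : z ∈ spectrum ℂ (unimodularPart A)) : ‖z‖ = 1 := by
  rw [← Matrix.spectrum_toLin', ← Module.End.hasEigenvalue_iff_mem_spectrum] at hz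
  obtain ⟨μ, v, hAv, hNv⟩ := exists_hasEigenvector_of_commute
    ((commute_unimodularPart A).map Matrix.toLinAlgEquiv') hz
  have hmem : v ∈ genEigenspace A μ := Module.End.eigenspace_le_maxGenEigenspace hAv.1
  have hA : A *ᵥ v = μ • v := hAv.apply_eq_smul
  have hN : unimodularPart A *ᵥ v = z • v := hNv.apply_eq_smul
  have hz : (‖μ‖ : ℂ)⁻¹ * μ + (if μ = 0 then 1 else 0) = z := by
    rw [unimodularPart_mulVec hmem, hA, smul_smul, ← add_smul] at hN
    exact smul_left_injective ℂ hNv.2 hN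
  rw [← hz]
  by_cases hμ : μ = 0 <;> simp [hμ]

open scoped Matrix.Norms.L2Operator in
variable (A) in
theorem exists_mem_subexponentialUnits_pow_eq_hyperbolicElement_pow_mul :
    ∃ N ∈ subexponentialUnits (Matrix (Fin n) (Fin n) ℂ),
      ∀ᶠ m in atTop, A ^ m = hyperbolicElement A ^ m * (N m).val := by
  have hunit : IsUnit (unimodularPart A) := by
    rw [← spectrum.zero_notMem_iff ℂ]
    exact fun h => by simpa using norm_eq_one_of_mem_spectrum_unimodularPart h
  obtain ⟨N, hN⟩ := hunit
  refine ⟨fun m => N ^ m, pow_mem_subexponentialUnits fun z hz => ?_, ?_⟩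
  · exact norm_eq_one_of_mem_spectrum_unimodularPart (hN ▸ hz)
  · filter_upwards [eventually_ge_atTop n, eventually_ne_atTop 0] with m hm hm0
    rw [Units.val_pow_eq_pow_val, hN, pow_eq_hyperbolicElement_pow_mul_unimodularPart_pow A hm hm0]

variable (A)

theorem antitone_eigenvalueModulus : Antitone (eigenvalueModulus A) := by
  intro i j hij
  rcases hij.eq_or_lt with rfl | hlt
  · exact le_rfl
  · exact List.pairwise_iff_get.1 (Multiset.pairwise_sort _ (· ≥ ·)) _ _ hlt

theorem exists_eigenvalue_enumeration : ∃ l : Fin n → ℂ,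
    (∀ i, ‖l i‖ = eigenvalueModulus A i) ∧ Finset.univ.val.map l = A.charpoly.roots := by
  obtain ⟨k, hk, hkmap⟩ := exists_list_map_eq (l := eigenvalueModuliList A)
    (Multiset.sort_eq (A.charpoly.roots.map fun z => ‖z‖) (· ≥ ·)).symm
  have hlen : k.length = n := by
    rw [← length_eigenvalueModuliList A, ← hkmap, List.length_map]
  refine ⟨fun i => k.get (i.cast hlen.symm), fun i => by simp [eigenvalueModulus, ← hkmap], ?_⟩
  subst hlen
  rw [Fin.univ_val_map, ← hk]
  exact congrArg _ (List.ofFn_get k)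

variable {A}

theorem eigenvalueModulus_nonneg (i : Fin n) : 0 ≤ eigenvalueModulus A i := by
  obtain ⟨l, hl, -⟩ := exists_eigenvalue_enumeration A
  exact hl i ▸ norm_nonneg _

theorem exists_basis_mem_genEigenspace {l : Fin n → ℂ}
    (hl : Finset.univ.val.map l = A.charpoly.roots) :
    ∃ b : Module.Basis (Fin n) ℂ (Fin n → ℂ), ∀ i, b i ∈ genEigenspace A (l i) := by
  have hint : DirectSum.IsInternal (genEigenspace A) :=
    (DirectSum.isInternal_submodule_iff_iSupIndep_and_iSup_eq_top _).2
      ⟨Module.End.independent_maxGenEigenspace _, Module.End.iSup_maxGenEigenspace_eq_top _⟩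
  have hfiber : ∀ μ, Nonempty (Fin (Module.finrank ℂ (genEigenspace A μ)) ≃ {i // l i = μ}) := by
    refine fun μ => ⟨Fintype.equivOfCardEq ?_⟩
    rw [Fintype.card_fin, finrank_genEigenspace, ← hl, Multiset.count_map, Fintype.card_subtype]
    simp [Finset.card_def, eq_comm]
  let σ : (Σ μ, Fin (Module.finrank ℂ (genEigenspace A μ))) ≃ Fin n :=
    (Equiv.sigmaCongrRight fun μ => (hfiber μ).some).trans (Equiv.sigmaFiberEquiv l)
  have hσ : ∀ x, l (σ x) = x.1 := fun x => ((hfiber x.1).some x.2).2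
  refine ⟨(hint.collectedBasis fun μ => Module.finBasis ℂ (genEigenspace A μ)).reindex σ,
    fun i => ?_⟩
  obtain ⟨x, rfl⟩ := σ.surjective i
  rw [hσ, Module.Basis.reindex_apply, Equiv.symm_apply_apply]
  exact hint.collectedBasis_mem _ _

theorem exists_hyperbolicElement_eq_mul_diagonal_mul_inv {l : Fin n → ℂ}
    {b : Module.Basis (Fin n) ℂ (Fin n → ℂ)} (hb : ∀ i, b i ∈ genEigenspace A (l i)) :
    ∃ M : Matrix.GeneralLinearGroup (Fin n) ℂ, hyperbolicElement A =
      M.val * Matrix.diagonal (fun i => (‖l i‖ : ℂ)) * (M⁻¹).val := by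
  let e := Pi.basisFun ℂ (Fin n)
  let M : Matrix.GeneralLinearGroup (Fin n) ℂ :=
    ⟨e.toMatrix b, b.toMatrix e, e.toMatrix_mul_toMatrix_flip b, b.toMatrix_mul_toMatrix_flip e⟩
  have hM : ∀ i, M.val *ᵥ Pi.single i 1 = b i := fun i => by
    rw [Matrix.mulVec_single_one]
    ext j
    simp [M, e, Module.Basis.toMatrix_apply]
  refine ⟨M, M.eq_mul_inv_iff_mul_eq.2 (Matrix.ext_of_mulVec_single fun i => ?_)⟩
  rw [← Matrix.mulVec_mulVec, ← Matrix.mulVec_mulVec, hM, hyperbolicElement_mulVec A _ _ (hb i),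
    Matrix.diagonal_mulVec_single, mul_one, ← hM i, ← Matrix.mulVec_smul, ← Pi.single_smul,
    smul_eq_mul, mul_one]

variable (A) in
theorem exists_hyperbolicElement_eq_mul_moduliDiagonal_mul_inv :
    ∃ M : Matrix.GeneralLinearGroup (Fin n) ℂ,
      hyperbolicElement A = M.val * moduliDiagonal A * (M⁻¹).val := by
  obtain ⟨l, hl, hroots⟩ := exists_eigenvalue_enumeration A
  obtain ⟨b, hb⟩ := exists_basis_mem_genEigenspace hroots
  simpa only [moduliDiagonal, hl] using exists_hyperbolicElement_eq_mul_diagonal_mul_inv hb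

end Spectral

section Limit

open scoped Matrix.Norms.L2Operator

variable {n : ℕ}

theorem leftAbs_eq_abs_conjTranspose (X : Matrix (Fin n) (Fin n) ℂ) : leftAbs X = CFC.abs Xᴴ := by
  rw [leftAbs, CFC.abs, Matrix.star_eq_conjTranspose, Matrix.conjTranspose_conjTranspose]

theorem tendsto_leftAbs_rpow_one_div {E : Matrix (Fin n) (Fin n) ℂ} (hE : 0 ≤ E)
    {x : ℕ → Matrix (Fin n) (Fin n) ℂ} {y : ℕ → (Matrix (Fin n) (Fin n) ℂ)ˣ}
    (hy : y ∈ subexponentialUnits (Matrix (Fin n) (Fin n) ℂ))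
    (hx : ∀ᶠ m in atTop, x m = E ^ m * (y m).val) :
    Tendsto (fun m : ℕ => CFC.rpow (leftAbs (x m)) (1 / (m : ℝ))) atTop (𝓝 E) := by
  refine (tendsto_abs_units_mul_pow_rpow_one_div hE
    (star_mem_subexponentialUnits hy)).congr' ?_
  filter_upwards [hx] with m hm
  rw [leftAbs_eq_abs_conjTranspose, hm, ← Matrix.star_eq_conjTranspose, star_mul, star_pow,
    (IsSelfAdjoint.of_nonneg hE).star_eq]
  rfl

theorem moduliDiagonal_nonneg (A : Matrix (Fin n) (Fin n) ℂ) : 0 ≤ moduliDiagonal A :=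
  Matrix.nonneg_iff_posSemidef.2 <| Matrix.PosSemidef.diagonal fun i => by
    simpa using eigenvalueModulus_nonneg i

theorem exists_mem_subexponentialUnits_mul_pow_mul_eq (A : Matrix (Fin n) (Fin n) ℂ)
    (B C M : Matrix.GeneralLinearGroup (Fin n) ℂ) {Q R : Matrix (Fin n) (Fin n) ℂ}
    (hM : hyperbolicElement A = M.val * moduliDiagonal A * (M⁻¹).val)
    (hQ : Q ∈ Matrix.unitaryGroup (Fin n) ℂ) (hR : R.IsUpperTriangular)
    (hQR : B.val * M.val = Q * R) :
    ∃ y ∈ subexponentialUnits (Matrix (Fin n) (Fin n) ℂ), ∀ᶠ m in atTop,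
      B.val * A ^ m * C.val = (Q * moduliDiagonal A * Qᴴ) ^ m * (y m).val := by
  let D := moduliDiagonal A
  let U : (Matrix (Fin n) (Fin n) ℂ)ˣ := Unitary.toUnits ⟨Q, hQ⟩
  have hRU : (U⁻¹ * (B * M)).val = R := by
    rw [Units.val_mul, Units.inv_mul_eq_iff_eq_mul]
    exact hQR
  have hd : Antitone fun i => ‖(eigenvalueModulus A i : ℂ)‖ := by
    simpa only [Complex.norm_of_nonneg (eigenvalueModulus_nonneg _)] using
      antitone_eigenvalueModulus A
  obtain ⟨S, hS, hRS⟩ :=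
    exists_mem_subexponentialUnits_mul_diagonal_pow_eq hd (U⁻¹ * (B * M)) (hRU.symm ▸ hR)
  obtain ⟨N, hN, hAN⟩ := exists_mem_subexponentialUnits_pow_eq_hyperbolicElement_pow_mul A
  refine ⟨(fun _ => U) * S * (fun _ => M⁻¹) * N * (fun _ => C),
    mul_mem (mul_mem (mul_mem (mul_mem (const_mem_subexponentialUnits U) hS)
      (const_mem_subexponentialUnits M⁻¹)) hN) (const_mem_subexponentialUnits C), ?_⟩
  filter_upwards [hAN] with m hm
  calc B.val * A ^ m * C.val
      = B.val * (M.val * D ^ m * (M⁻¹).val * (N m).val) * C.val := by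
        rw [hm, hM, Units.conj_pow]
    _ = Q * (R * D ^ m) * (M⁻¹).val * (N m).val * C.val := by
        simp only [← mul_assoc, hQR]
    _ = Q * (D ^ m * (S m).val) * (M⁻¹).val * (N m).val * C.val := by
        rw [← hRU]
        exact congrArg (Q * · * (M⁻¹).val * (N m).val * C.val) (hRS m)
    _ = (U.val * D ^ m * (U⁻¹).val) * (U.val * (S m).val * (M⁻¹).val * (N m).val * C.val) := by
        simp only [mul_assoc, Units.inv_mul_cancel_left]
        rfl
    _ = (Q * D * Qᴴ) ^ m * (U.val * (S m).val * (M⁻¹).val * (N m).val * C.val) := by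
        rw [← Units.conj_pow]
        rfl

theorem tendsto_leftAbs_mul_pow_mul_rpow_one_div (A : Matrix (Fin n) (Fin n) ℂ)
    (B C M : Matrix.GeneralLinearGroup (Fin n) ℂ) {Q R : Matrix (Fin n) (Fin n) ℂ}
    (hM : hyperbolicElement A = M.val * moduliDiagonal A * (M⁻¹).val)
    (hQ : Q ∈ Matrix.unitaryGroup (Fin n) ℂ) (hR : R.IsUpperTriangular)
    (hQR : B.val * M.val = Q * R) :
    Tendsto (fun m : ℕ => CFC.rpow (leftAbs (B.val * A ^ m * C.val)) (1 / (m : ℝ))) atTop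
      (𝓝 (Q * moduliDiagonal A * Qᴴ)) := by
  obtain ⟨y, hy, hBAC⟩ := exists_mem_subexponentialUnits_mul_pow_mul_eq A B C M hM hQ hR hQR
  exact tendsto_leftAbs_rpow_one_div
    (star_right_conjugate_nonneg (moduliDiagonal_nonneg A) Q) hy hBAC

end Limit

theorem mainTheorem2 {n : ℕ} (A : Matrix (Fin n) (Fin n) ℂ)
    (B : Matrix.GeneralLinearGroup (Fin n) ℂ) :
    ∃ X : Matrix (Fin n) (Fin n) ℂ,
      (∀ C : Matrix.GeneralLinearGroup (Fin n) ℂ,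
        Filter.Tendsto
          (fun m : ℕ => CFC.rpow (leftAbs (B.val * A ^ m * C.val)) (1 / (m : ℝ)))
          Filter.atTop (𝓝 X)) ∧
      (∀ (M : Matrix.GeneralLinearGroup (Fin n) ℂ) (Q R : Matrix (Fin n) (Fin n) ℂ),
        hyperbolicElement A = M.val * moduliDiagonal A * (M⁻¹).val →
        Q ∈ Matrix.unitaryGroup (Fin n) ℂ →
        R.IsUpperTriangular →
        B.val * M.val = Q * R →
        X = Q * moduliDiagonal A * Qᴴ) := by
  obtain ⟨M, hM⟩ := exists_hyperbolicElement_eq_mul_moduliDiagonal_mul_inv A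
  obtain ⟨Q, R, hQ, hR, hQR⟩ := exists_unitary_mul_isUpperTriangular (B.val * M.val)
  have hlim := fun C => tendsto_leftAbs_mul_pow_mul_rpow_one_div A B C M hM hQ hR hQR
  refine ⟨Q * moduliDiagonal A * Qᴴ, hlim, fun M' Q' R' hM' hQ' hR' hQR' => ?_⟩
  exact tendsto_nhds_unique (hlim 1)
    (tendsto_leftAbs_mul_pow_mul_rpow_one_div A B 1 M' hM' hQ' hR' hQR')
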